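/- A finitary matroid is a pair $M=(E,\mathcal{I})$, where $E$ is a (possibly infinite) set and $\mathcal{I}\subseteq\mathcal{P}(E)$, such that: (I) $\emptyset\in\mathcal{I}$; (II) $\mathcal{I}$ is closed under taking subsets; (III) if $I,J\in\mathcal{I}$ with $|I|<|J|$, then there is an $e\in J\setminus I$ such that $I\cup\{e\}\in\mathcal{I}$; (IV) if all finite subsets of an infinite set $X\subseteq E$ are in $\mathcal{I}$, then $X\in\mathcal{I}$. Equivalently, it is a (possibly infinite) matroid in which a set is independent as soon as all of its finite subsets are. A base of $M$ is a $\subseteq$-maximal element of $\mathcal{I}$. For a set $X$, let $[X]^{<\aleph_0}$ denote the set of finite subsets of $X$. Theorem. Let $M=(E,\mathcal{I})$ be a finitary matroid and let $B_0$ and $B_1$ be bases of $M$. Then there is a bijection $F:[B_0]^{<\aleph_0}\rightarrow[B_1]^{<\aleph_0}$ such that $(B_0\setminus I)\cup F(I)$ is a base of $M$ for every $I\in[B_0]^{<\aleph_0}$. -/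

import Mathlib

/-! The countable case is a game. Keep two bases, `U = (B₀ \ I) ∪ J` and `V = (B₁ \ B) ∪ ((A \ I) ∪
J)`. For a new element `e` of `B₀ \ A`, one symmetric exchange yields a partner `f` for which both
`U - e + f` and `V - f + e` are bases. Selecting the pair changes only `U` and skipping it changes
only `V`, so the partner is fixed before it is known whether `e` lies in the set to be exchanged.
Running through an enumeration therefore encodes finite sets injectively. The same game played from
`B₁` gives an injection back, and Schröder–Bernstein, applied to the relation of reachable pairs,
gives the bijection.

In general, finitarity places each `e ∈ B₀` in a countable `P ⊆ B₀` with the same span as a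
countable `Q ⊆ B₁`. An exchange between `X ⊆ B₀` and `Y ⊆ B₁` of equal span can then be enlarged by
the countable case for `P \ X` and `Q \ Y`, and Zorn's lemma exhausts `B₀`. Exchanges are recorded
as sets of pairs so that they can be ordered by inclusion. -/

/-- A node of a back-and-forth construction: `left` and `right` are the elements considered so far
on the two sides, and `leftSel`, `rightSel` are those among them that have been selected. -/
structure ExchangeState (P Q : Type*) where
  leftSel : Finset P
  left : Finset P
  rightSel : Finset Q
  right : Finset Q

/-! ### Back-and-forth on finite subsets -/

namespace ExchangeState

variable {P Q : Type*}

/-- The state with the two sides interchanged. -/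
def swap (s : ExchangeState P Q) : ExchangeState Q P :=
  ⟨s.rightSel, s.right, s.leftSel, s.left⟩

/-- The state in which nothing has been considered. -/
def start (P Q : Type*) : ExchangeState P Q := ⟨∅, ∅, ∅, ∅⟩

variable [DecidableEq P] [DecidableEq Q]

/-- Consider the pair `(e, f)` without selecting it. -/
def skip (s : ExchangeState P Q) (e : P) (f : Q) : ExchangeState P Q :=
  ⟨s.leftSel, insert e s.left, s.rightSel, insert f s.right⟩

/-- Consider the pair `(e, f)` and select it. -/
def select (s : ExchangeState P Q) (e : P) (f : Q) : ExchangeState P Q :=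
  ⟨insert e s.leftSel, insert e s.left, insert f s.rightSel, insert f s.right⟩

/-- If every admissible state can be extended by every new element on the left, then there is an
injection between the finite sets of the two sides all of whose pairs occur in admissible states. -/
theorem exists_injective_of_forth [Countable P] (S : ExchangeState P Q → Prop)
    (h0 : S (start P Q)) (hsub : ∀ s, S s → s.rightSel ⊆ s.right)
    (forth : ∀ s, S s → ∀ e ∉ s.left, ∃ f ∉ s.right, S (s.skip e f) ∧ S (s.select e f)) :
    ∃ F : Finset P → Finset Q, Function.Injective F ∧
      ∀ I, ∃ s, S s ∧ s.leftSel = I ∧ s.rightSel = F I := by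
  rcases isEmpty_or_nonempty P with hP | hP
  · refine ⟨fun _ ↦ ∅, Function.injective_of_subsingleton _, fun I ↦ ⟨_, h0, ?_, rfl⟩⟩
    exact Subsingleton.elim _ _
  obtain ⟨enum, henum⟩ := exists_surjective_nat P
  -- The partner `f` is quantified before the decision `b`: injectivity rests on this order.
  have hnext : ∃ nxt : {s // S s} → P → Prop → {s // S s},
      (∀ s e b, e ∈ s.1.left → nxt s e b = s) ∧
      ∀ s e, e ∉ s.1.left → ∃ f ∉ s.1.right, ∀ b,
        (b → (nxt s e b).1 = s.1.select e f) ∧ (¬ b → (nxt s e b).1 = s.1.skip e f) := by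
    classical
    choose f hf h1 h2 using forth
    refine ⟨fun s e b ↦ if he : e ∈ s.1.left then s else
      if b then ⟨s.1.select e (f s.1 s.2 e he), h2 _ _ _ _⟩
      else ⟨s.1.skip e (f s.1 s.2 e he), h1 _ _ _ _⟩, ?_, ?_⟩
    · intro s e b he
      simp [he]
    · intro s e he
      refine ⟨f s.1 s.2 e he, hf _ _ _ _, fun b ↦ ⟨fun hb ↦ ?_, fun hb ↦ ?_⟩⟩ <;> simp [he, hb]
  obtain ⟨nxt, hold, hnew⟩ := hnext
  obtain ⟨run, run_zero, run_succ⟩ : ∃ run : Finset P → ℕ → {s // S s},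
      (∀ I, run I 0 = ⟨start P Q, h0⟩) ∧
      ∀ I n, run I (n + 1) = nxt (run I n) (enum n) (enum n ∈ I) :=
    ⟨fun I n ↦ Nat.rec ⟨start P Q, h0⟩ (fun n s ↦ nxt s (enum n) (enum n ∈ I)) n,
      fun _ ↦ rfl, fun _ _ ↦ rfl⟩
  have hcases : ∀ I n, (enum n ∈ (run I n).1.left ∧ run I (n + 1) = run I n) ∨
      ∃ f ∉ (run I n).1.right, enum n ∉ (run I n).1.left ∧
        ((enum n ∈ I ∧ (run I (n + 1)).1 = (run I n).1.select (enum n) f) ∨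
        (enum n ∉ I ∧ (run I (n + 1)).1 = (run I n).1.skip (enum n) f)) := by
    intro I n
    by_cases he : enum n ∈ (run I n).1.left
    · exact .inl ⟨he, by rw [run_succ, hold _ _ _ he]⟩
    · obtain ⟨f, hf, h⟩ := hnew _ _ he
      refine .inr ⟨f, hf, he, ?_⟩
      by_cases hI : enum n ∈ I
      · exact .inl ⟨hI, by rw [run_succ, (h _).1 hI]⟩
      · exact .inr ⟨hI, by rw [run_succ, (h _).2 hI]⟩
  have hleftSel : ∀ I n x, x ∈ (run I n).1.leftSel ↔ x ∈ I ∧ x ∈ (run I n).1.left := by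
    intro I n
    induction n with
    | zero => simp [run_zero, start]
    | succ n ih =>
      intro x
      rcases hcases I n with ⟨h, h'⟩ | ⟨f, hf, he, ⟨hI, h'⟩ | ⟨hI, h'⟩⟩
      · rw [h', ih]
      · simp only [h', select, Finset.mem_insert, ih]
        clear * - hI
        grind
      · simp only [h', skip, Finset.mem_insert, ih]
        clear * - hI
        grind
  have hleft_succ : ∀ I n, (run I n).1.left ⊆ (run I (n + 1)).1.left ∧
      enum n ∈ (run I (n + 1)).1.left := by
    intro I n
    rcases hcases I n with ⟨h, h'⟩ | ⟨f, hf, he, ⟨hI, h'⟩ | ⟨hI, h'⟩⟩ <;>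
      rw [h'] <;> simp [select, skip]
    exact h
  have hleft_mono : ∀ I, Monotone fun n ↦ (run I n).1.left :=
    fun I ↦ monotone_nat_of_le_succ fun n ↦ (hleft_succ I n).1
  have hrightSel_mono : ∀ I, Monotone fun n ↦ (run I n).1.rightSel := by
    refine fun I ↦ monotone_nat_of_le_succ fun n ↦ ?_
    rcases hcases I n with ⟨h, h'⟩ | ⟨f, hf, he, ⟨hI, h'⟩ | ⟨hI, h'⟩⟩ <;>
      rw [h'] <;> simp [select, skip]
  have hright_step : ∀ I n, (run I n).1.right ⊆ (run I (n + 1)).1.right ∧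
      ∀ x ∈ (run I n).1.right,
        (x ∈ (run I (n + 1)).1.rightSel ↔ x ∈ (run I n).1.rightSel) := by
    intro I n
    rcases hcases I n with ⟨h, h'⟩ | ⟨f, hf, he, ⟨hI, h'⟩ | ⟨hI, h'⟩⟩
    · simp [h']
    · rw [h']
      refine ⟨Finset.subset_insert _ _, fun x hx ↦ ?_⟩
      simp [select, show x ≠ f from fun h ↦ hf (h ▸ hx)]
    · rw [h']
      exact ⟨Finset.subset_insert _ _, fun x hx ↦ Iff.rfl⟩
  have hright : ∀ I m n, m ≤ n → (run I m).1.right ⊆ (run I n).1.right ∧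
      ∀ x ∈ (run I m).1.right,
        (x ∈ (run I n).1.rightSel ↔ x ∈ (run I m).1.rightSel) := by
    intro I m n hmn
    induction n, hmn using Nat.le_induction with
    | base => simp
    | succ n _ ih =>
      refine ⟨ih.1.trans (hright_step I n).1, fun x hx ↦ ?_⟩
      rw [(hright_step I n).2 x (ih.1 hx), ih.2 x hx]
  have hall : ∀ I : Finset P, ∃ n, I ⊆ (run I n).1.left := by
    intro I
    choose g hg using henum
    refine ⟨I.sup g + 1, fun x hx ↦ ?_⟩
    have h := (hleft_succ I (g x)).2
    rw [hg] at h
    exact hleft_mono I (Nat.succ_le_succ (Finset.le_sup hx)) h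
  choose N hN using hall
  -- From stage `N I` on, all of `I` has been considered, so nothing more is selected.
  have hstable : ∀ I n, (run I n).1.rightSel ⊆ (run I (N I)).1.rightSel := by
    intro I n
    rcases le_total n (N I) with h | h
    · exact hrightSel_mono I h
    · induction n, h using Nat.le_induction with
      | base => rfl
      | succ n hn ih =>
        have hI : I ⊆ (run I n).1.left := (hN I).trans (hleft_mono I hn)
        rcases hcases I n with ⟨h, h'⟩ | ⟨f, hf, he, ⟨hI', h'⟩ | ⟨hI', h'⟩⟩
        · rwa [h']
        · exact absurd (hI hI') he
        · rw [h']
          exact ih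
  have hmem : ∀ I n x, x ∈ (run I n).1.right → x ∈ (run I (N I)).1.rightSel →
      x ∈ (run I n).1.rightSel := by
    intro I n x hx hxN
    rcases le_total n (N I) with h | h
    · exact ((hright I n _ h).2 x hx).1 hxN
    · exact hrightSel_mono I h hxN
  refine ⟨fun I ↦ (run I (N I)).1.rightSel, ?_, fun I ↦ ⟨_, (run I (N I)).2, ?_, rfl⟩⟩
  · intro I I' hII'
    -- If two runs first disagreed at stage `n`, the same `f` would be selected in one and skipped
    -- in the other. Both decisions are permanent, so the final right selections would differ.
    have hrun : ∀ n, run I n = run I' n := by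
      intro n
      induction n with
      | zero => rw [run_zero, run_zero]
      | succ n ih =>
        rw [run_succ, run_succ, ← ih]
        by_cases he : enum n ∈ (run I n).1.left
        · rw [hold _ _ _ he, hold _ _ _ he]
        obtain ⟨f, hf, h⟩ := hnew _ _ he
        have key : ∀ I₁ I₂, run I₁ n = run I n → run I₂ n = run I n →
            (run I₁ (N I₁)).1.rightSel = (run I₂ (N I₂)).1.rightSel →
            enum n ∈ I₁ → enum n ∈ I₂ := by
          intro I₁ I₂ h₁ h₂ h₁₂ he₁
          by_contra he₂
          have e₁ := run_succ I₁ n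
          have e₂ := run_succ I₂ n
          rw [h₁, Subtype.ext_iff, (h _).1 he₁] at e₁
          rw [h₂, Subtype.ext_iff, (h _).2 he₂] at e₂
          have hf₁ : f ∈ (run I₁ (N I₁)).1.rightSel :=
            hstable I₁ (n + 1) (by rw [e₁]; simp [select])
          rw [h₁₂] at hf₁
          have hf₂ := hmem I₂ (n + 1) f (by rw [e₂]; simp [skip]) hf₁
          rw [e₂] at hf₂
          exact hf (hsub _ (run I n).2 hf₂)
        have hiff : (enum n ∈ I) = (enum n ∈ I') :=
          propext ⟨key I I' rfl ih.symm hII', key I' I ih.symm rfl hII'.symm⟩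
        rw [hiff]
    ext x
    have h₁ := hleft_mono I (le_max_left (N I) (N I'))
    have h₂ := hleft_mono I' (le_max_right (N I) (N I'))
    have h₃ := hleftSel I (max (N I) (N I')) x
    have h₄ := hleftSel I' (max (N I) (N I')) x
    rw [hrun] at h₃
    have h₅ := hrun (max (N I) (N I'))
    constructor
    · intro hx
      have := h₁ (hN I hx)
      simp only [h₅] at this
      exact (h₄.1 (h₃.2 ⟨hx, this⟩)).1
    · intro hx
      exact (h₃.1 (h₄.2 ⟨hx, h₂ (hN I' hx)⟩)).1
  · ext x
    rw [hleftSel]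
    exact ⟨fun h ↦ h.1, fun h ↦ ⟨h, hN I h⟩⟩

/-- Back-and-forth for countable types: the pairs of selected sets occurring in admissible states
contain the graph of a bijection between the finite sets of the two sides. -/
theorem exists_bijective_of_back_and_forth [Countable P] [Countable Q]
    (S : ExchangeState P Q → Prop) (h0 : S (start P Q))
    (hleft : ∀ s, S s → s.leftSel ⊆ s.left) (hright : ∀ s, S s → s.rightSel ⊆ s.right)
    (forth : ∀ s, S s → ∀ e ∉ s.left, ∃ f ∉ s.right, S (s.skip e f) ∧ S (s.select e f))
    (back : ∀ s, S s → ∀ f ∉ s.right, ∃ e ∉ s.left, S (s.skip e f) ∧ S (s.select e f)) :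
    ∃ F : Finset P → Finset Q, Function.Bijective F ∧
      ∀ I, ∃ s, S s ∧ s.leftSel = I ∧ s.rightSel = F I := by
  obtain ⟨f, hf, hfS⟩ := exists_injective_of_forth S h0 hright forth
  obtain ⟨g, hg, hgS⟩ := exists_injective_of_forth (fun s : ExchangeState Q P ↦ S s.swap)
    h0 (fun s hs ↦ hleft _ hs) (fun s hs e he ↦ back _ hs e he)
  -- Every pair in the Schröder–Bernstein bijection comes from the graph of `f` or the reversed
  -- graph of `g`, so it is still reachable.
  refine Function.Embedding.schroeder_bernstein_of_rel hf hg
    (fun I J ↦ ∃ s, S s ∧ s.leftSel = I ∧ s.rightSel = J) hfS fun J ↦ ?_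
  obtain ⟨s, hs, h₁, h₂⟩ := hgS J
  exact ⟨s.swap, hs, h₂, h₁⟩

end ExchangeState

/-! ### Symmetric exchange and the countable case -/

namespace Matroid

open Set

variable {α : Type*} {M : Matroid α}

/-- Symmetric base exchange. -/
theorem IsBase.exists_symm_exchange {B B' : Set α} {e : α} (hB : M.IsBase B) (hB' : M.IsBase B')
    (he : e ∈ B) (he' : e ∉ B') :
    ∃ f ∈ B', f ∉ B ∧ M.IsBase (insert f (B \ {e})) ∧ M.IsBase (insert e (B' \ {f})) := by
  have heE := hB.subset_ground he
  have hcl : e ∈ M.closure B' := by rwa [hB'.closure_eq]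
  have hC := hB'.fundCircuit_isCircuit heE he'
  -- Otherwise the rest of the circuit would put `e` in the closure of `B \ {e}`, against
  -- independence of `B`.
  have hnot : ¬ M.fundCircuit e B' \ {e} ⊆ M.closure (B \ {e}) := fun h ↦
    hB.indep.notMem_closure_sdiff_of_mem he <| M.closure_subset_closure_of_subset_closure h <|
      hC.mem_closure_sdiff_singleton_of_mem (M.mem_fundCircuit e B')
  obtain ⟨f, ⟨hfC, hfe⟩, hf⟩ := not_subset.1 hnot
  have hfB' : f ∈ B' := ((M.fundCircuit_subset_insert e B') hfC).resolve_left hfe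
  have hfB : f ∉ B := fun h ↦ hf (M.mem_closure_of_mem' ⟨h, hfe⟩ (hB.subset_ground h))
  refine ⟨f, hfB', hfB, hB.exchange_base_of_notMem_closure he hf (hB'.subset_ground hfB'), ?_⟩
  have hi := (hB'.indep.mem_fundCircuit_iff hcl he').1 hfC
  rw [← insert_sdiff_singleton_comm (Ne.symm hfe)] at hi
  exact hB'.exchange_isBase_of_indep he' hi

/-- The invariant of the back-and-forth construction: after considering `A ⊆ B₀` and `B ⊆ B₁`
and selecting `I ⊆ A` and `J ⊆ B`, the sets `B₀ \ A` and `B₁ \ B` both complete `(A \ I) ∪ J`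
to a base, without overlaps. -/
structure IsExchangeState (M : Matroid α) (B₀ B₁ I A J B : Set α) : Prop where
  left_subset : A ⊆ B₀
  leftSel_subset : I ⊆ A
  right_subset : B ⊆ B₁
  rightSel_subset : J ⊆ B
  disjoint_left : Disjoint (B₀ \ I) J
  disjoint_right : Disjoint (B₁ \ B) ((A \ I) ∪ J)
  isBase_left : M.IsBase ((B₀ \ I) ∪ J)
  isBase_right : M.IsBase ((B₁ \ B) ∪ ((A \ I) ∪ J))

variable {B₀ B₁ I A J B : Set α} {e f : α}

/-- The left base is untouched and the right one becomes `V - f + e`. The condition `hef` keeps its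
parts disjoint; `e = f` is the degenerate exchange. -/
theorem IsExchangeState.skip (h : M.IsExchangeState B₀ B₁ I A J B) (he : e ∈ B₀ \ A)
    (hf : f ∈ B₁ \ B) (hef : e = f ∨ e ∉ (B₁ \ B) ∪ ((A \ I) ∪ J))
    (hbase : M.IsBase (insert e (((B₁ \ B) ∪ ((A \ I) ∪ J)) \ {f}))) :
    M.IsExchangeState B₀ B₁ I (insert e A) J (insert f B) := by
  obtain ⟨h1, h2, h3, h4, h5, h6, h7, h8⟩ := h
  rw [Set.disjoint_left] at h5 h6
  have hfn : f ∉ (A \ I) ∪ J := h6 hf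
  have heI : e ∉ I := fun h ↦ he.2 (h2 h)
  refine ⟨insert_subset he.1 h1, h2.trans (subset_insert _ _), insert_subset hf.1 h3,
    h4.trans (subset_insert _ _), Set.disjoint_left.2 h5, ?_, h7, ?_⟩
  · rw [Set.disjoint_left]
    clear h1 h2 h3 h4 h5 h7 h8 hbase
    intro x hx hx'
    have := @h6 x
    simp only [mem_sdiff, mem_union, mem_insert_iff] at *
    grind
  · convert hbase using 1
    ext x
    clear h1 h2 h3 h4 h5 h6 h7 h8 hbase
    simp only [mem_sdiff, mem_union, mem_insert_iff, mem_singleton_iff] at *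
    grind

theorem IsExchangeState.select (h : M.IsExchangeState B₀ B₁ I A J B) (he : e ∈ B₀ \ A)
    (hf : f ∈ B₁ \ B) (hef : e = f ∨ f ∉ (B₀ \ I) ∪ J)
    (hbase : M.IsBase (insert f (((B₀ \ I) ∪ J) \ {e}))) :
    M.IsExchangeState B₀ B₁ (insert e I) (insert e A) (insert f J) (insert f B) := by
  obtain ⟨h1, h2, h3, h4, h5, h6, h7, h8⟩ := h
  rw [Set.disjoint_left] at h5 h6
  have hfn : f ∉ (A \ I) ∪ J := h6 hf
  have heI : e ∉ I := fun h ↦ he.2 (h2 h)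
  have heJ : e ∉ J := h5 ⟨he.1, heI⟩
  have hV : (B₁ \ insert f B) ∪ ((insert e A \ insert e I) ∪ insert f J) =
      (B₁ \ B) ∪ ((A \ I) ∪ J) := by
    ext x
    have := he.2
    clear h1 h2 h3 h4 h5 h6 h7 h8 hbase hef
    simp only [mem_sdiff, mem_union, mem_insert_iff] at *
    grind
  refine ⟨insert_subset he.1 h1, insert_subset_insert h2, insert_subset hf.1 h3,
    insert_subset_insert h4, ?_, ?_, ?_, hV ▸ h8⟩
  · rw [Set.disjoint_left]
    intro x hx hx'
    have := @h5 x
    clear h1 h2 h3 h4 h5 h6 h7 h8 hbase hV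
    simp only [mem_sdiff, mem_union, mem_insert_iff] at *
    grind
  · rw [Set.disjoint_left]
    intro x hx hx'
    have := @h6 x
    clear h1 h2 h3 h4 h5 h6 h7 h8 hbase hV hef
    simp only [mem_sdiff, mem_union, mem_insert_iff] at *
    grind
  · convert hbase using 1
    ext x
    clear h1 h2 h3 h4 h5 h6 h7 h8 hbase hV
    simp only [mem_sdiff, mem_union, mem_insert_iff, mem_singleton_iff] at *
    grind

/-- An element common to both bases is its own partner. Otherwise symmetric exchange gives `f ∈ V \
U`, which forces `f ∈ B₁ \ B` since `A \ I` and `J` lie in `U`. The clause `e = f ∨ f ∉ B₀ \ I`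
later confines partners to the part where the two bases differ. -/
theorem IsExchangeState.forth (h : M.IsExchangeState B₀ B₁ I A J B) (he : e ∈ B₀ \ A) :
    ∃ f ∈ B₁ \ B, (e = f ∨ f ∉ B₀ \ I) ∧
      M.IsExchangeState B₀ B₁ I (insert e A) J (insert f B) ∧
      M.IsExchangeState B₀ B₁ (insert e I) (insert e A) (insert f J) (insert f B) := by
  have heI : e ∈ B₀ \ I := ⟨he.1, fun h' ↦ he.2 (h.leftSel_subset h')⟩
  have heJ : e ∉ J := Set.disjoint_left.1 h.disjoint_left heI
  by_cases heV : e ∈ (B₁ \ B) ∪ ((A \ I) ∪ J)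
  · have heB : e ∈ B₁ \ B := by
      rcases heV with h' | h' | h'
      exacts [h', absurd h'.1 he.2, absurd h' heJ]
    refine ⟨e, heB, .inl rfl, h.skip he heB (.inl rfl) ?_, h.select he heB (.inl rfl) ?_⟩
    · rw [insert_sdiff_singleton, insert_eq_of_mem heV]
      exact h.isBase_right
    · rw [insert_sdiff_singleton, insert_eq_of_mem (.inl heI)]
      exact h.isBase_left
  obtain ⟨f, hfV, hfU, hU, hV⟩ := h.isBase_left.exists_symm_exchange h.isBase_right (.inl heI) heV
  have hf : f ∈ B₁ \ B := by
    rcases hfV with h' | h' | h'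
    exacts [h', absurd (.inl ⟨h.left_subset h'.1, h'.2⟩) hfU, absurd (.inr h') hfU]
  exact ⟨f, hf, .inr fun h' ↦ hfU (.inl h'), h.skip he hf (.inr heV) hV,
    h.select he hf (.inr hfU) hU⟩

theorem IsExchangeState.back (h : M.IsExchangeState B₀ B₁ I A J B) (hf : f ∈ B₁ \ B) :
    ∃ e ∈ B₀ \ A, (e = f ∨ e ∉ B₁ \ B) ∧
      M.IsExchangeState B₀ B₁ I (insert e A) J (insert f B) ∧
      M.IsExchangeState B₀ B₁ (insert e I) (insert e A) (insert f J) (insert f B) := by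
  have hfn : f ∉ (A \ I) ∪ J := Set.disjoint_left.1 h.disjoint_right hf
  by_cases hfU : f ∈ (B₀ \ I) ∪ J
  · have hfA : f ∈ B₀ \ A := by
      rcases hfU with h' | h'
      exacts [⟨h'.1, fun h'' ↦ hfn (.inl ⟨h'', h'.2⟩)⟩, absurd (.inr h') hfn]
    refine ⟨f, hfA, .inl rfl, h.skip hfA hf (.inl rfl) ?_, h.select hfA hf (.inl rfl) ?_⟩
    · rw [insert_sdiff_singleton, insert_eq_of_mem (.inl hf)]
      exact h.isBase_right
    · rw [insert_sdiff_singleton, insert_eq_of_mem hfU]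
      exact h.isBase_left
  obtain ⟨e, heU, heV, hV, hU⟩ := h.isBase_right.exists_symm_exchange h.isBase_left (.inl hf) hfU
  have he : e ∈ B₀ \ A := by
    rcases heU with h' | h'
    exacts [⟨h'.1, fun h'' ↦ heV (.inr (.inl ⟨h'', h'.2⟩))⟩, absurd (.inr (.inr h')) heV]
  exact ⟨e, he, .inr fun h' ↦ heV (.inl h'), h.skip he hf (.inr heV) hV,
    h.select he hf (.inr hfU) hU⟩

/-- If two bases differ only in the countable sets `P` and `Q`, then the finite subsets of `P`
can be exchanged bijectively for the finite subsets of `Q`. -/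
theorem exists_bijective_isBase_of_countable {P Q : Set α} (hB₀ : M.IsBase B₀)
    (hB₁ : M.IsBase B₁) (hP : P.Countable) (hQ : Q.Countable) (hPB : P ⊆ B₀) (hQB : Q ⊆ B₁)
    (hPQ : B₀ \ P = B₁ \ Q) :
    ∃ F : Finset P → Finset Q, Function.Bijective F ∧ F ∅ = ∅ ∧
      ∀ I : Finset P, M.IsBase ((B₀ \ (↑) '' (I : Set P)) ∪ (↑) '' (F I : Set Q)) := by
  classical
  have := hP.to_subtype
  have := hQ.to_subtype
  -- The cardinality clause serves to make `F ∅ = ∅`.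
  let S : ExchangeState P Q → Prop := fun s ↦ s.leftSel.card = s.rightSel.card ∧
    M.IsExchangeState B₀ B₁ ((↑) '' (s.leftSel : Set P)) ((↑) '' (s.left : Set P))
      ((↑) '' (s.rightSel : Set Q)) ((↑) '' (s.right : Set Q))
  have hskipsel : ∀ s, S s → ∀ e ∉ s.left, ∀ f ∉ s.right,
      M.IsExchangeState B₀ B₁ ((↑) '' (s.leftSel : Set P)) (insert ↑e ((↑) '' (s.left : Set P)))
        ((↑) '' (s.rightSel : Set Q)) (insert ↑f ((↑) '' (s.right : Set Q))) →
      M.IsExchangeState B₀ B₁ (insert ↑e ((↑) '' (s.leftSel : Set P)))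
        (insert ↑e ((↑) '' (s.left : Set P))) (insert ↑f ((↑) '' (s.rightSel : Set Q)))
        (insert ↑f ((↑) '' (s.right : Set Q))) →
      S (s.skip e f) ∧ S (s.select e f) := by
    intro s hs e he f hf h₁ h₂
    have heI : e ∉ s.leftSel := fun h ↦ he <| by
      simpa using hs.2.leftSel_subset (mem_image_of_mem _ (Finset.mem_coe.2 h))
    have hfJ : f ∉ s.rightSel := fun h ↦ hf <| by
      simpa using hs.2.rightSel_subset (mem_image_of_mem _ (Finset.mem_coe.2 h))
    refine ⟨⟨hs.1, ?_⟩, ⟨?_, ?_⟩⟩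
    · simpa [ExchangeState.skip, image_insert_eq] using h₁
    · simp [ExchangeState.select, heI, hfJ, hs.1]
    · simpa [ExchangeState.select, image_insert_eq] using h₂
  have hstart : S (ExchangeState.start P Q) := by
    refine ⟨rfl, ?_⟩
    constructor <;> simp [ExchangeState.start, hB₀, hB₁]
  have hleft : ∀ s, S s → s.leftSel ⊆ s.left := by
    intro s hs
    have := hs.2.leftSel_subset
    rwa [image_subset_image_iff Subtype.val_injective, Finset.coe_subset] at this
  have hright : ∀ s, S s → s.rightSel ⊆ s.right := by
    intro s hs
    have := hs.2.rightSel_subset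
    rwa [image_subset_image_iff Subtype.val_injective, Finset.coe_subset] at this
  have hforth : ∀ s, S s → ∀ e ∉ s.left, ∃ f ∉ s.right, S (s.skip e f) ∧ S (s.select e f) := by
    intro s hs e he
    obtain ⟨f, hf, hef, h₁, h₂⟩ := hs.2.forth (e := (e : α)) ⟨hPB e.2, by simpa using he⟩
    have hfQ : f ∈ Q := by
      by_contra hfQ
      have hfP : f ∈ B₀ \ P := hPQ ▸ ⟨hf.1, hfQ⟩
      rcases hef with rfl | hef
      · exact hfP.2 e.2
      · refine hef ⟨hfP.1, ?_⟩
        rintro ⟨x, -, rfl⟩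
        exact hfP.2 x.2
    have hf' : (⟨f, hfQ⟩ : Q) ∉ s.right := fun h ↦ hf.2 ⟨_, h, rfl⟩
    exact ⟨⟨f, hfQ⟩, hf', hskipsel s hs e he ⟨f, hfQ⟩ hf' h₁ h₂⟩
  have hback : ∀ s, S s → ∀ f ∉ s.right, ∃ e ∉ s.left, S (s.skip e f) ∧ S (s.select e f) := by
    intro s hs f hf
    obtain ⟨e, he, hef, h₁, h₂⟩ := hs.2.back (f := (f : α)) ⟨hQB f.2, by simpa using hf⟩
    have heP : e ∈ P := by
      by_contra heP
      have heQ : e ∈ B₁ \ Q := hPQ ▸ ⟨he.1, heP⟩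
      rcases hef with rfl | hef
      · exact heQ.2 f.2
      · refine hef ⟨heQ.1, ?_⟩
        rintro ⟨x, -, rfl⟩
        exact heQ.2 x.2
    have he' : (⟨e, heP⟩ : P) ∉ s.left := fun h ↦ he.2 ⟨_, h, rfl⟩
    exact ⟨⟨e, heP⟩, he', hskipsel s hs ⟨e, heP⟩ he' f hf h₁ h₂⟩
  obtain ⟨F, hF, hFS⟩ :=
    ExchangeState.exists_bijective_of_back_and_forth S hstart hleft hright hforth hback
  refine ⟨F, hF, ?_, fun I ↦ ?_⟩
  · obtain ⟨s, hs, h₁, h₂⟩ := hFS ∅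
    rw [← h₂, ← Finset.card_eq_zero, ← hs.1, h₁, Finset.card_empty]
  · obtain ⟨s, hs, h₁, h₂⟩ := hFS I
    rw [← h₂, ← h₁]
    exact hs.2.isBase_left

end Matroid

/-! ### Gluing exchanges along sets of equal closure -/

namespace Matroid

open Set

variable {α : Type*} {M : Matroid α} {B₀ B₁ X Y : Set α}

/-- In a base `K ∪ D`, the part `K` may be replaced by any independent set with the same closure. -/
theorem IsBase.union_of_closure_eq {K K' D : Set α} (h : M.IsBase (K ∪ D)) (hKD : Disjoint K D)
    (hK' : M.Indep K') (hcl : M.closure K = M.closure K') : M.IsBase (K' ∪ D) := by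
  have hK : M.Indep K := h.indep.subset subset_union_left
  have hb : M.IsBasis K (M.closure K) := hK.isBasis_closure
  have hb' : M.IsBasis K' (M.closure K) := hcl ▸ hK'.isBasis_closure
  have hdisj : Disjoint (M.closure K) D := by
    rw [Set.disjoint_left]
    intro x hx hxD
    have hxK : x ∈ K := (h.indep.closure_inter_eq_self_of_subset subset_union_left).subset
      ⟨hx, .inr hxD⟩
    exact Set.disjoint_left.1 hKD hxK hxD
  -- Independence of `D` in the contraction by `M.closure K` does not depend on which basis of that
  -- flat is used.
  have hD := (hb.contract_indep_iff (J := D)).2 ⟨by rw [union_comm]; exact h.indep, hdisj⟩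
  have hi : M.Indep (K' ∪ D) := by
    rw [union_comm]
    exact (hb'.contract_indep_iff.1 hD).1
  refine hi.isBase_of_ground_subset_closure ?_
  rw [← h.closure_eq]
  refine M.closure_subset_closure_of_subset_closure (union_subset ?_ ?_)
  · exact (M.subset_closure K).trans (hcl.subset.trans (M.closure_subset_closure subset_union_left))
  · exact (subset_union_right).trans (M.subset_closure _ hi.subset_ground)

/-- If `K ⊆ closure X` and `K` completes `B \ X` to a base, then `K` spans `X`. -/
theorem IsBase.closure_eq_of_sdiff_union {B K : Set α} (hB : M.IsBase B) (hX : X ⊆ B)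
    (hK : K ⊆ M.closure X) (h : M.IsBase (K ∪ (B \ X))) : M.closure K = M.closure X := by
  -- Enlarge `K` to a basis `L` of `M.closure X`. Then `L ∪ (B \ X)` is a base containing the base
  -- `K ∪ (B \ X)`, so they coincide.
  obtain ⟨L, hL, hKL⟩ := (h.indep.subset subset_union_left).subset_isBasis_of_subset hK
  have hXi : M.Indep X := hB.indep.subset hX
  have hcl : M.closure X = M.closure L := by rw [hL.closure_eq_closure, closure_closure]
  have hbase : M.IsBase (L ∪ (B \ X)) :=
    IsBase.union_of_closure_eq (by rwa [union_sdiff_cancel hX]) disjoint_sdiff_right hL.indep hcl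
  have heq := h.eq_of_subset_isBase hbase (union_subset_union_left _ hKL)
  have hLK : L ⊆ K := by
    intro x hx
    have hx' : x ∈ K ∪ (B \ X) := heq ▸ .inl hx
    refine hx'.resolve_right fun hxB ↦ hxB.2 ?_
    exact (hB.indep.closure_inter_eq_self_of_subset hX).subset ⟨hL.subset hx, hxB.1⟩
  rw [hcl, hKL.antisymm hLK]

/-- `R` is the graph of a bijection between the finite subsets of `X` and those of `Y`, every pair
`(I, J)` of which yields a base `(B \ I) ∪ J`. -/
structure IsExchangeRel (M : Matroid α) (B X Y : Set α) (R : Set (Set α × Set α)) : Prop where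
  finite : ∀ p ∈ R, p.1.Finite ∧ p.2.Finite
  subset : ∀ p ∈ R, p.1 ⊆ X ∧ p.2 ⊆ Y
  exists_right : ∀ I ⊆ X, I.Finite → ∃ J, (I, J) ∈ R
  exists_left : ∀ J ⊆ Y, J.Finite → ∃ I, (I, J) ∈ R
  fst_eq_iff : ∀ p ∈ R, ∀ q ∈ R, p.1 = q.1 ↔ p.2 = q.2
  isBase : ∀ p ∈ R, M.IsBase ((B \ p.1) ∪ p.2)

theorem exists_isExchangeRel_of_countable {P Q : Set α} (hB₀ : M.IsBase B₀)
    (hB₁ : M.IsBase B₁) (hP : P.Countable) (hQ : Q.Countable) (hPB : P ⊆ B₀) (hQB : Q ⊆ B₁)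
    (hPQ : B₀ \ P = B₁ \ Q) : ∃ R, M.IsExchangeRel B₀ P Q R ∧ (∅, ∅) ∈ R := by
  obtain ⟨F, hF, hF0, hbase⟩ :=
    exists_bijective_isBase_of_countable hB₀ hB₁ hP hQ hPB hQB hPQ
  have hfin : ∀ {T I : Set α}, I ⊆ T → I.Finite → ∃ I' : Finset T, (↑) '' (I' : Set T) = I := by
    intro T I hI hIf
    refine ⟨(hIf.preimage Subtype.val_injective.injOn).toFinset, ?_⟩
    simpa using hI
  refine ⟨range fun I : Finset P ↦ ((↑) '' (I : Set P), (↑) '' (F I : Set Q)),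
    ⟨?_, ?_, ?_, ?_, ?_, ?_⟩, ⟨∅, by simp [hF0]⟩⟩
  · rintro _ ⟨I, rfl⟩
    exact ⟨I.finite_toSet.image _, (F I).finite_toSet.image _⟩
  · rintro _ ⟨I, rfl⟩
    exact ⟨Subtype.coe_image_subset _ _, Subtype.coe_image_subset _ _⟩
  · intro I hI hIf
    obtain ⟨I, rfl⟩ := hfin hI hIf
    exact ⟨_, I, rfl⟩
  · intro J hJ hJf
    obtain ⟨J, rfl⟩ := hfin hJ hJf
    obtain ⟨I, rfl⟩ := hF.2 J
    exact ⟨_, I, rfl⟩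
  · rintro _ ⟨I, rfl⟩ _ ⟨I', rfl⟩
    simp only [Subtype.val_injective.image_injective.eq_iff, Finset.coe_inj, hF.1.eq_iff]
  · rintro _ ⟨I, rfl⟩
    exact hbase I

/-- Two exchange relations living on disjoint parts can be combined. -/
theorem IsExchangeRel.union {P Q : Set α} {R G : Set (Set α × Set α)}
    (hR : M.IsExchangeRel B₀ X Y R) (hG : M.IsExchangeRel B₀ P Q G) (hB₀ : M.IsBase B₀)
    (hX : X ⊆ B₀) (hYX : Y ⊆ M.closure X) (hPX : Disjoint P X) (hQX : Disjoint Q X)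
    (hQY : Disjoint Q Y) :
    M.IsExchangeRel B₀ (X ∪ P) (Y ∪ Q)
      {p | ∃ r ∈ R, ∃ g ∈ G, p = (r.1 ∪ g.1, r.2 ∪ g.2)} := by
  have split : ∀ {A B a b a' b' : Set α}, Disjoint B A → a ⊆ A → a' ⊆ A → b ⊆ B → b' ⊆ B →
      (a ∪ b = a' ∪ b' ↔ a = a' ∧ b = b') := by
    intro A B a b a' b' hAB ha ha' hb hb'
    refine ⟨fun h ↦ ?_, fun h ↦ by rw [h.1, h.2]⟩
    rw [Set.disjoint_left] at hAB
    constructor <;> ext x <;> have hx := Set.ext_iff.1 h x <;> have := @ha x <;>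
      have := @hb x <;> have := @ha' x <;> have := @hb' x <;> have := @hAB x <;>
      simp only [mem_union] at hx <;> tauto
  refine ⟨?_, ?_, ?_, ?_, ?_, ?_⟩
  · rintro _ ⟨r, hr, g, hg, rfl⟩
    exact ⟨(hR.finite r hr).1.union (hG.finite g hg).1, (hR.finite r hr).2.union (hG.finite g hg).2⟩
  · rintro _ ⟨r, hr, g, hg, rfl⟩
    exact ⟨union_subset_union (hR.subset r hr).1 (hG.subset g hg).1,
      union_subset_union (hR.subset r hr).2 (hG.subset g hg).2⟩
  · intro I hI hIf
    obtain ⟨J₁, h₁⟩ := hR.exists_right (I ∩ X) inter_subset_right (hIf.inter_of_left _)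
    obtain ⟨J₂, h₂⟩ := hG.exists_right (I ∩ P) inter_subset_right (hIf.inter_of_left _)
    refine ⟨J₁ ∪ J₂, _, h₁, _, h₂, ?_⟩
    rw [← inter_union_distrib_left, inter_eq_left.2 hI]
  · intro J hJ hJf
    obtain ⟨I₁, h₁⟩ := hR.exists_left (J ∩ Y) inter_subset_right (hJf.inter_of_left _)
    obtain ⟨I₂, h₂⟩ := hG.exists_left (J ∩ Q) inter_subset_right (hJf.inter_of_left _)
    refine ⟨I₁ ∪ I₂, _, h₁, _, h₂, ?_⟩
    rw [← inter_union_distrib_left, inter_eq_left.2 hJ]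
  · rintro _ ⟨r, hr, g, hg, rfl⟩ _ ⟨r', hr', g', hg', rfl⟩
    simp only
    rw [split hPX (hR.subset r hr).1 (hR.subset r' hr').1 (hG.subset g hg).1 (hG.subset g' hg').1,
      split hQY (hR.subset r hr).2 (hR.subset r' hr').2 (hG.subset g hg).2 (hG.subset g' hg').2,
      hR.fst_eq_iff r hr r' hr', hG.fst_eq_iff g hg g' hg']
  · rintro _ ⟨⟨I₁, J₁⟩, hr, ⟨I₂, J₂⟩, hg, rfl⟩
    obtain ⟨hI₁, hJ₁⟩ := hR.subset _ hr
    obtain ⟨hI₂, hJ₂⟩ := hG.subset _ hg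
    have b₁ := hR.isBase _ hr
    have b₂ := hG.isBase _ hg
    simp only at hI₁ hJ₁ hI₂ hJ₂ b₁ b₂ ⊢
    rw [Set.disjoint_left] at hPX hQX
    have e₁ : (B₀ \ I₁) ∪ J₁ = ((X \ I₁) ∪ J₁) ∪ (B₀ \ X) := by
      ext x
      have := @hI₁ x
      have := @hX x
      simp only [mem_union, mem_sdiff]
      tauto
    have e₂ : (B₀ \ I₂) ∪ J₂ = X ∪ (((B₀ \ X) \ I₂) ∪ J₂) := by
      ext x
      have := @hI₂ x
      have := @hX x
      have := @hPX x
      simp only [mem_union, mem_sdiff]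
      tauto
    have e₃ : (B₀ \ (I₁ ∪ I₂)) ∪ (J₁ ∪ J₂) =
        ((X \ I₁) ∪ J₁) ∪ (((B₀ \ X) \ I₂) ∪ J₂) := by
      ext x
      have := @hI₁ x
      have := @hI₂ x
      have := @hX x
      have := @hPX x
      simp only [mem_union, mem_sdiff]
      tauto
    rw [e₁] at b₁
    rw [e₂] at b₂
    rw [e₃]
    -- `(X \ I₁) ∪ J₁` spans the same flat as `X`, so it may replace `X` in the base given by the
    -- second exchange.
    refine b₂.union_of_closure_eq ?_ (b₁.indep.subset subset_union_left) ?_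
    · rw [Set.disjoint_left]
      rintro x hx (hx' | hx')
      exacts [hx'.1.2 hx, hQX (hJ₂ hx') hx]
    · refine (hB₀.closure_eq_of_sdiff_union hX (union_subset ?_ (hJ₁.trans hYX)) b₁).symm
      exact sdiff_subset.trans (M.subset_closure X (hX.trans hB₀.subset_ground))

/-! ### Countable pieces and Zorn's lemma -/

/-- In a finitary matroid, every element of a base lies in a countable subset of it that has the
same closure as some countable subset of another given base. -/
theorem IsBase.exists_countable_closure_eq [M.Finitary] (hB₀ : M.IsBase B₀) (hB₁ : M.IsBase B₁)
    {e : α} (he : e ∈ B₀) :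
    ∃ P ⊆ B₀, ∃ Q ⊆ B₁, P.Countable ∧ Q.Countable ∧ e ∈ P ∧
      P ⊆ M.closure Q ∧ Q ⊆ M.closure P := by
  have hspan : ∀ {B B' : Set α}, M.IsBase B → M.IsBase B' →
      ∀ x : α, ∃ C ⊆ B', C.Countable ∧ (x ∈ B → x ∈ M.closure C) := by
    intro B B' hB hB' x
    by_cases hx : x ∈ B
    · obtain ⟨C, hC, hCf, -, hxC⟩ := exists_mem_finite_closure_of_mem_closure
        (show x ∈ M.closure B' by rw [hB'.closure_eq]; exact hB.subset_ground hx)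
      exact ⟨C, hC, hCf.countable, fun _ ↦ hxC⟩
    · exact ⟨∅, empty_subset _, countable_empty, fun h ↦ absurd h hx⟩
  choose C hC hCc hCcl using hspan hB₀ hB₁
  choose D hD hDc hDcl using hspan hB₁ hB₀
  -- Close `{e}` off under countable supports: `C x ⊆ B₁` spans `x ∈ B₀`, and `D y ⊆ B₀` spans `y ∈
  -- B₁`.
  let A : ℕ → Set α := fun n ↦ Nat.rec {e} (fun _ S ↦ ⋃ x ∈ S, ⋃ y ∈ C x, D y) n
  have hA : ∀ n, A (n + 1) = ⋃ x ∈ A n, ⋃ y ∈ C x, D y := fun _ ↦ rfl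
  have hAc : ∀ n, (A n).Countable := by
    intro n
    induction n with
    | zero => exact countable_singleton e
    | succ n ih => exact ih.biUnion fun x _ ↦ (hCc x).biUnion fun y _ ↦ hDc y
  have hAB : ∀ n, A n ⊆ B₀ := by
    intro n
    cases n with
    | zero => exact singleton_subset_iff.2 he
    | succ n => exact iUnion₂_subset fun x _ ↦ iUnion₂_subset fun y _ ↦ hD y
  refine ⟨⋃ n, A n, iUnion_subset hAB, ⋃ x ∈ ⋃ n, A n, C x, iUnion₂_subset fun x _ ↦ hC x,
    countable_iUnion hAc, (countable_iUnion hAc).biUnion fun x _ ↦ hCc x,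
    mem_iUnion.2 ⟨0, rfl⟩, ?_, ?_⟩
  · intro x hx
    refine M.closure_subset_closure ?_ (hCcl x (iUnion_subset hAB hx))
    exact subset_biUnion_of_mem (u := C) hx
  · intro y hy
    obtain ⟨x, hx, hy⟩ := mem_iUnion₂.1 hy
    obtain ⟨n, hx⟩ := mem_iUnion.1 hx
    refine M.closure_subset_closure ?_ (hDcl y (hC x hy))
    refine Subset.trans ?_ (subset_iUnion A (n + 1))
    rw [hA]
    exact fun z hz ↦ mem_iUnion₂.2 ⟨x, hx, mem_iUnion₂.2 ⟨y, hy, hz⟩⟩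

/-- An exchange relation between subsets of two bases with the same closure can be extended to
cover any given element of the first base. -/
theorem IsExchangeRel.exists_extension [M.Finitary] {R : Set (Set α × Set α)}
    (hR : M.IsExchangeRel B₀ X Y R) (hB₀ : M.IsBase B₀) (hB₁ : M.IsBase B₁) (hX : X ⊆ B₀)
    (hY : Y ⊆ B₁) (hXY : X ⊆ M.closure Y) (hYX : Y ⊆ M.closure X) {e : α} (he : e ∈ B₀) :
    ∃ X' ⊆ B₀, ∃ Y' ⊆ B₁, X' ⊆ M.closure Y' ∧ Y' ⊆ M.closure X' ∧ e ∈ X' ∧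
      ∃ R', R ⊆ R' ∧ M.IsExchangeRel B₀ X' Y' R' := by
  obtain ⟨P, hP, Q, hQ, hPc, hQc, heP, hPQ, hQP⟩ := hB₀.exists_countable_closure_eq hB₁ he
  have hcl : M.closure X = M.closure Y :=
    (M.closure_subset_closure_of_subset_closure hXY).antisymm
      (M.closure_subset_closure_of_subset_closure hYX)
  have hX' : X ∪ P ⊆ B₀ := union_subset hX hP
  have hY' : Y ∪ Q ⊆ B₁ := union_subset hY hQ
  have hXY' : X ∪ P ⊆ M.closure (Y ∪ Q) :=
    union_subset (hXY.trans (M.closure_subset_closure subset_union_left))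
      (hPQ.trans (M.closure_subset_closure subset_union_right))
  have hYX' : Y ∪ Q ⊆ M.closure (X ∪ P) :=
    union_subset (hYX.trans (M.closure_subset_closure subset_union_left))
      (hQP.trans (M.closure_subset_closure subset_union_right))
  have hcl' : M.closure (X ∪ P) = M.closure (Y ∪ Q) :=
    (M.closure_subset_closure_of_subset_closure hXY').antisymm
      (M.closure_subset_closure_of_subset_closure hYX')
  have hQX : ∀ x ∈ Q \ Y, x ∉ X := fun x hx hxX ↦ hx.2 <|
    (hB₁.indep.closure_inter_eq_self_of_subset hY).subset ⟨hXY hxX, hQ hx.1⟩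
  have hYZ : ∀ x ∈ Y ∪ Q, x ∉ B₀ \ (X ∪ P) := fun x hx hxZ ↦ hxZ.2 <|
    (hB₀.indep.closure_inter_eq_self_of_subset hX').subset ⟨hYX' hx, hxZ.1⟩
  have hb₁ : M.IsBase ((Y ∪ Q) ∪ (B₀ \ (X ∪ P))) :=
    IsBase.union_of_closure_eq (by rwa [union_sdiff_cancel hX']) disjoint_sdiff_right
      (hB₁.indep.subset hY') hcl'
  have e₁ : (Y ∪ Q) ∪ (B₀ \ (X ∪ P)) = Y ∪ ((Q \ Y) ∪ (B₀ \ (X ∪ P))) := by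
    rw [← union_assoc, union_sdiff_self]
  rw [e₁] at hb₁
  -- This auxiliary base differs from `B₀` only in having `Q \ Y` in place of `P \ X`, so the
  -- countable case applies to the two.
  have hb₂ : M.IsBase (X ∪ ((Q \ Y) ∪ (B₀ \ (X ∪ P)))) := by
    refine hb₁.union_of_closure_eq ?_ (hB₀.indep.subset hX) hcl.symm
    rw [Set.disjoint_left]
    rintro x hx (hx' | hx')
    exacts [hx'.2 hx, hYZ x (.inl hx) hx']
  obtain ⟨G, hG, hG0⟩ := exists_isExchangeRel_of_countable (P := P \ X) (Q := Q \ Y) hB₀ hb₂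
    (hPc.mono sdiff_subset) (hQc.mono sdiff_subset) (sdiff_subset.trans hP)
    (subset_union_left.trans subset_union_right) (by
      ext x
      have := hQX x
      have := hYZ x
      have := @hX x
      simp only [mem_union, mem_sdiff] at *
      tauto)
  have hU := hR.union hG hB₀ hX hYX disjoint_sdiff_left (Set.disjoint_left.2 hQX)
    disjoint_sdiff_left
  rw [union_sdiff_self, union_sdiff_self] at hU
  refine ⟨X ∪ P, hX', Y ∪ Q, hY', hXY', hYX', .inr heP, _, fun r hr ↦ ?_, hU⟩
  -- Joining each old pair with `(∅, ∅)` shows that the old relation is contained in the new one.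
  exact ⟨r, hr, _, hG0, by simp⟩

/-- An exchange relation determines the sets it lives on, monotonically. -/
theorem IsExchangeRel.subset_of_subset {X' Y' : Set α} {R R' : Set (Set α × Set α)}
    (hR : M.IsExchangeRel B₀ X Y R) (hR' : M.IsExchangeRel B₁ X' Y' R') (h : R ⊆ R') :
    X ⊆ X' ∧ Y ⊆ Y' := by
  refine ⟨fun x hx ↦ ?_, fun y hy ↦ ?_⟩
  · obtain ⟨J, hJ⟩ := hR.exists_right {x} (singleton_subset_iff.2 hx) (finite_singleton x)
    exact (hR'.subset _ (h hJ)).1 rfl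
  · obtain ⟨I, hI⟩ := hR.exists_left {y} (singleton_subset_iff.2 hy) (finite_singleton y)
    exact (hR'.subset _ (h hI)).2 rfl

/-- Every clause involves one finite set or at most two pairs, and these already live in a single
member of the chain. -/
theorem IsExchangeRel.sUnion_of_isChain {c : Set (Set (Set α × Set α))} (hc : IsChain (· ⊆ ·) c)
    (hne : c.Nonempty) {X Y : Set (Set α × Set α) → Set α}
    (h : ∀ R ∈ c, M.IsExchangeRel B₀ (X R) (Y R) R) :
    M.IsExchangeRel B₀ (⋃ R ∈ c, X R) (⋃ R ∈ c, Y R) (⋃₀ c) := by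
  have hdX : DirectedOn (fun R R' ↦ X R ⊆ X R') c := fun R hR R' hR' ↦ by
    obtain ⟨S, hS, h₁, h₂⟩ := hc.directedOn R hR R' hR'
    exact ⟨S, hS, ((h R hR).subset_of_subset (h S hS) h₁).1,
      ((h R' hR').subset_of_subset (h S hS) h₂).1⟩
  have hdY : DirectedOn (fun R R' ↦ Y R ⊆ Y R') c := fun R hR R' hR' ↦ by
    obtain ⟨S, hS, h₁, h₂⟩ := hc.directedOn R hR R' hR'
    exact ⟨S, hS, ((h R hR).subset_of_subset (h S hS) h₁).2,
      ((h R' hR').subset_of_subset (h S hS) h₂).2⟩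
  refine ⟨?_, ?_, ?_, ?_, ?_, ?_⟩
  · rintro p ⟨R, hR, hp⟩
    exact (h R hR).finite p hp
  · rintro p ⟨R, hR, hp⟩
    exact ⟨((h R hR).subset p hp).1.trans (subset_biUnion_of_mem (u := X) hR),
      ((h R hR).subset p hp).2.trans (subset_biUnion_of_mem (u := Y) hR)⟩
  · intro I hI hIf
    lift I to Finset α using hIf
    obtain ⟨R, hR, hIR⟩ := DirectedOn.exists_mem_subset_of_finset_subset_biUnion hne hdX hI
    obtain ⟨J, hJ⟩ := (h R hR).exists_right I hIR I.finite_toSet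
    exact ⟨J, R, hR, hJ⟩
  · intro J hJ hJf
    lift J to Finset α using hJf
    obtain ⟨R, hR, hJR⟩ := DirectedOn.exists_mem_subset_of_finset_subset_biUnion hne hdY hJ
    obtain ⟨I, hI⟩ := (h R hR).exists_left J hJR J.finite_toSet
    exact ⟨I, R, hR, hI⟩
  · rintro p ⟨R, hR, hp⟩ q ⟨R', hR', hq⟩
    obtain ⟨S, hS, h₁, h₂⟩ := hc.directedOn R hR R' hR'
    exact (h S hS).fst_eq_iff p (h₁ hp) q (h₂ hq)
  · rintro p ⟨R, hR, hp⟩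
    exact (h R hR).isBase p hp

/-- Any two bases of a finitary matroid are linked by an exchange relation. -/
theorem IsBase.exists_isExchangeRel [M.Finitary] (hB₀ : M.IsBase B₀) (hB₁ : M.IsBase B₁) :
    ∃ R, M.IsExchangeRel B₀ B₀ B₁ R := by
  let 𝓡 : Set (Set (Set α × Set α)) := {R | ∃ X Y, X ⊆ B₀ ∧ Y ⊆ B₁ ∧ X ⊆ M.closure Y ∧
    Y ⊆ M.closure X ∧ M.IsExchangeRel B₀ X Y R}
  have h0 : {(∅, ∅)} ∈ 𝓡 := by
    refine ⟨∅, ∅, empty_subset _, empty_subset _, empty_subset _, empty_subset _, ?_⟩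
    constructor <;> simp [hB₀]
  obtain ⟨R, -, hRmax⟩ := zorn_subset_nonempty 𝓡 (fun c hc𝓡 hc hne ↦ by
    have hc' : ∀ R ∈ c, ∃ X Y, X ⊆ B₀ ∧ Y ⊆ B₁ ∧ X ⊆ M.closure Y ∧ Y ⊆ M.closure X ∧
      M.IsExchangeRel B₀ X Y R := fun R hR ↦ hc𝓡 hR
    choose! X Y hX hY hXY hYX h using hc'
    refine ⟨⋃₀ c, ⟨⋃ R ∈ c, X R, ⋃ R ∈ c, Y R, iUnion₂_subset hX, iUnion₂_subset hY,
      iUnion₂_subset fun R hR ↦ (hXY R hR).trans (M.closure_subset_closure ?_),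
      iUnion₂_subset fun R hR ↦ (hYX R hR).trans (M.closure_subset_closure ?_),
      IsExchangeRel.sUnion_of_isChain hc hne h⟩, fun _ ↦ subset_sUnion_of_mem⟩
    · exact subset_biUnion_of_mem (u := Y) hR
    · exact subset_biUnion_of_mem (u := X) hR) _ h0
  obtain ⟨X, Y, hX, hY, hXY, hYX, hR⟩ := hRmax.prop
  have hXeq : X = B₀ := hX.antisymm fun e he ↦ by
    obtain ⟨X', hX', Y', hY', hXY', hYX', heX', R', hRR', hR'⟩ :=
      hR.exists_extension hB₀ hB₁ hX hY hXY hYX he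
    have hR'R := hRmax.le_of_ge (y := R') ⟨X', Y', hX', hY', hXY', hYX', hR'⟩ hRR'
    exact (hR'.subset_of_subset hR hR'R).1 heX'
  subst hXeq
  -- Now `Y ⊆ B₁` spans the base `B₀`, so it is itself a base.
  have hYeq : Y = B₁ := by
    refine IsBase.eq_of_subset_isBase ?_ hB₁ hY
    refine (hB₁.indep.subset hY).isBase_of_ground_subset_closure ?_
    rw [← hB₀.closure_eq]
    exact M.closure_subset_closure_of_subset_closure hXY
  exact ⟨R, hYeq ▸ hR⟩

end Matroid

theorem mainTheorem2 {α : Type*} (M : Matroid α) [M.Finitary] (B₀ B₁ : Set α)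
    (hB₀ : M.IsBase B₀) (hB₁ : M.IsBase B₁) :
    ∃ F : {I : Set α // I ⊆ B₀ ∧ I.Finite} → {J : Set α // J ⊆ B₁ ∧ J.Finite},
      Function.Bijective F ∧
        ∀ I : {I : Set α // I ⊆ B₀ ∧ I.Finite},
          M.IsBase ((B₀ \ (I : Set α)) ∪ (F I : Set α)) := by
  obtain ⟨R, hR⟩ := hB₀.exists_isExchangeRel hB₁
  have hex : ∀ I : {I : Set α // I ⊆ B₀ ∧ I.Finite}, ∃ J, (I.1, J) ∈ R :=
    fun I ↦ hR.exists_right I I.2.1 I.2.2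
  choose F hF using hex
  refine ⟨fun I ↦ ⟨F I, (hR.subset _ (hF I)).2, (hR.finite _ (hF I)).2⟩, ⟨?_, ?_⟩,
    fun I ↦ hR.isBase _ (hF I)⟩
  · intro I I' h
    exact Subtype.ext ((hR.fst_eq_iff _ (hF I) _ (hF I')).2 (congrArg Subtype.val h))
  · intro J
    obtain ⟨I, hI⟩ := hR.exists_left J J.2.1 J.2.2
    refine ⟨⟨I, (hR.subset _ hI).1, (hR.finite _ hI).1⟩, Subtype.ext ?_⟩
    exact (hR.fst_eq_iff _ (hF _) _ hI).1 rfl
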